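/- Let $n\ge 0$ be an integer, write $[n-1]=\{1,2,\dots,n-1\}$ (empty if $n\le 1$), and let $\mathfrak S_n$ be the set of permutations $w=a_1a_2\cdots a_n$ of $\{1,\dots,n\}$. For $w\in\mathfrak S_n$ put $$D(w)=\{i\in[n-1] : a_i>a_{i+1}\},\qquad C(w)=\{i\in[n-1] : a_j<a_k \text{ for all } j\le i<k\},$$ $$\mathrm{inv}(w)=\#\{(i,j) : i<j,\ a_i>a_j\}.$$ For $S\subseteq[n-1]$ write $\overline S=[n-1]\setminus S$. Let $q$ be an invertible element of a commutative ring $R$ (for example, an indeterminate $q$ and $R=\mathbb Z[q,q^{-1}]$), and define matrices $A(q)$, $B(q)$, $\Gamma(q)$ over $R$, with rows and columns indexed by the subsets $S,T$ of $[n-1]$, by $$A(q)_{ST}=\sum_{\substack{w\in\mathfrak S_n\\ \overline S\subseteq C(w),\ T\subseteq D(w)}}q^{\mathrm{inv}(w)},\qquad B(q)_{ST}=\sum_{\substack{w\in\mathfrak S_n\\ \overline S\subseteq C(w),\ D(w)=T}}q^{\mathrm{inv}(w)},\qquad \Gamma(q)_{ST}=\sum_{\substack{w\in\mathfrak S_n\\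 C(w)=\overline S,\ D(w)=T}}q^{\mathrm{inv}(w)}.$$ Let $A(1/q)$ and $\Gamma(1/q)$ be the matrices obtained by replacing $q$ by $q^{-1}$. Then $A(q)$, $B(q)$ and $\Gamma(q)$ are invertible over $R$, and for all $S,T\subseteq[n-1]$ $$A(q)^{-1}_{ST}=(-1)^{\#S+\#T}A(1/q)_{ST},$$ $$B(q)^{-1}_{ST}=(-1)^{\#S+\#T}\sum_{\substack{w\in\mathfrak S_n\\ C(w)=\overline S,\ T\subseteq D(w)}}q^{-\mathrm{inv}(w)},$$ $$\Gamma(q)^{-1}_{ST}=(-1)^{\#S+\#T}\,\Gamma(1/q)_{ST}.$$ -/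

import Mathlib

namespace PermStat

/-- The descent set of a permutation of `n` letters.  Letters and positions are numbered
`0, …, n - 1`, and `i : Fin (n - 1)` stands for the element `i + 1` of `{1, …, n - 1}`. -/
def descentSet {n : ℕ} (w : Equiv.Perm (Fin n)) : Finset (Fin (n - 1)) :=
  Finset.univ.filter fun i =>
    w ⟨i.val + 1, by have := i.isLt; omega⟩ < w ⟨i.val, by have := i.isLt; omega⟩

/-- The connectivity set: `i` belongs to it if every value in the first `i + 1` positions
(those numbered `0, …, i`) is smaller than every value in a later position. -/
def connectivitySet {n : ℕ} (w : Equiv.Perm (Fin n)) : Finset (Fin (n - 1)) :=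
  Finset.univ.filter fun i =>
    ∀ j k : Fin n, j.val ≤ i.val → i.val < k.val → w j < w k

/-- The number of inversions of a permutation. -/
def inv {n : ℕ} (w : Equiv.Perm (Fin n)) : ℕ :=
  (Finset.univ.filter fun p : Fin n × Fin n => p.1 < p.2 ∧ w p.2 < w p.1).card

/-- The matrix `A(q)`, with rows and columns indexed by the subsets of `{1, …, n - 1}`. -/
def matA {R : Type*} [CommRing R] (n : ℕ) (q : R) :
    Matrix (Finset (Fin (n - 1))) (Finset (Fin (n - 1))) R :=
  fun S T => ∑ w : Equiv.Perm (Fin n) with Sᶜ ⊆ connectivitySet w ∧ T ⊆ descentSet w, q ^ inv w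

/-- The matrix `B(q)`. -/
def matB {R : Type*} [CommRing R] (n : ℕ) (q : R) :
    Matrix (Finset (Fin (n - 1))) (Finset (Fin (n - 1))) R :=
  fun S T => ∑ w : Equiv.Perm (Fin n) with Sᶜ ⊆ connectivitySet w ∧ descentSet w = T, q ^ inv w

/-- The matrix `Γ(q)`. -/
def matΓ {R : Type*} [CommRing R] (n : ℕ) (q : R) :
    Matrix (Finset (Fin (n - 1))) (Finset (Fin (n - 1))) R :=
  fun S T => ∑ w : Equiv.Perm (Fin n) with connectivitySet w = Sᶜ ∧ descentSet w = T, q ^ inv w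

end PermStat

/-!
Call `U`-*blocks* the maximal intervals of positions not separated by an element outside `U`; the
function `block U` numbers them.  The condition `Uᶜ ⊆ connectivitySet v` says that `v` maps every
`U`-block to itself, so these `v` form a (Young) subgroup `W_U`, and `U ⊆ descentSet w` says that
`w` is decreasing on every `U`-block.

Let `T ⊆ U ⊆ S`.  If `w` is decreasing on `U`-blocks and `v ∈ W_U`, then `inv (w * v) = inv w -
inv v` (`inv_mul_add_inv`), and every permutation `y` is uniquely of the form `w * v`: sort `y`
decreasingly inside each block (`exists_sort_blocks`, `sort_blocks_unique`).  Moreover `T` consists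
of descents of `v` exactly when it consists of ascents of `w * v`.  Hence
`A(q)_{SU} A(1/q)_{UT} = ∑ q ^ inv y` over the `y ∈ W_S` without descents in `T`
(`matA_mul_matA_inv`), which does not depend on `U`.  Summing with the sign `(-1) ^ #U` over
`T ⊆ U ⊆ S` gives `0` for `T ≠ S`, and for `T = S` only `y = 1` remains.  This is the inverse of
`A(q)`.

With `Z_{ST} = [T ⊆ S]` and `J = diag ((-1) ^ #S)` one has `B = Z Γ`, `A = Z Γ Z` and `Z J Z = J`,
so the inverses of `B(q)` and `Γ(q)` follow from that of `A(q)`.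
-/

namespace PermStat

open Finset

variable {n : ℕ}

/-! ### Blocks -/

/-- The number of the `U`-block containing position `i`: how many elements outside `U` separate
`i` from the positions to its left.  Here `k : Fin (n - 1)` separates the positions `k` and
`k + 1`. -/
def block (U : Finset (Fin (n - 1))) (i : Fin n) : ℕ :=
  #{k ∈ Uᶜ | k.val < i.val}

theorem block_mono (U : Finset (Fin (n - 1))) : Monotone (block U) := by
  intro i j hij
  refine card_le_card fun k hk => ?_
  simp only [mem_filter] at hk ⊢
  exact ⟨hk.1, hk.2.trans_le hij⟩

theorem block_lt_block {U : Finset (Fin (n - 1))} {k : Fin (n - 1)} (hk : k ∉ U) {i j : Fin n}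
    (hi : i.val ≤ k.val) (hj : k.val < j.val) : block U i < block U j := by
  refine card_lt_card ⟨fun l hl => ?_, fun h => ?_⟩
  · simp only [mem_filter] at hl ⊢
    exact ⟨hl.1, by omega⟩
  · have := h (mem_filter.2 ⟨mem_compl.2 hk, hj⟩)
    simp only [mem_filter] at this
    omega

theorem block_eq_of_mem {U : Finset (Fin (n - 1))} {k : Fin (n - 1)} (hk : k ∈ U) {i j : Fin n}
    (hi : i.val = k.val) (hj : j.val = k.val + 1) : block U i = block U j := by
  unfold block
  congr 1
  ext l
  simp only [mem_filter, mem_compl, and_congr_right_iff]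
  intro hl
  have : l.val ≠ k.val := fun h => hl (Fin.ext h ▸ hk)
  omega

theorem mem_connectivitySet_iff {w : Equiv.Perm (Fin n)} {k : Fin (n - 1)} :
    k ∈ connectivitySet w ↔ ∀ i, (w i).val ≤ k.val ↔ i.val ≤ k.val := by
  simp only [connectivitySet, mem_filter, mem_univ, true_and]
  constructor
  · intro h i
    -- A set mapped into itself by a permutation is mapped onto itself.
    have key : ∀ P : Finset (Fin n), (∀ j ∈ P, w j ∈ P) → w i ∈ P → i ∈ P := by
      intro P hP hi
      have himg : P.image w = P :=
        eq_of_subset_of_card_le (image_subset_iff.2 hP)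
          (card_image_of_injective P w.injective).ge
      rw [← himg] at hi
      obtain ⟨j, hj, hji⟩ := mem_image.1 hi
      exact w.injective hji ▸ hj
    constructor
    · intro hw
      by_contra hi
      have := key (univ.filter fun j => j.val ≤ k.val) (fun j hj => by
        have := h j i (by simpa using hj) (by omega)
        simp only [mem_filter, mem_univ, true_and]
        omega) (by simpa using hw)
      simp at this
      omega
    · intro hi
      by_contra hw
      have := key (univ.filter fun j => k.val < j.val) (fun j hj => by
        have := h i j hi (by simpa using hj)
        simp only [mem_filter, mem_univ, true_and]
        omega) (by simpa using hw)
      simp at this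
      omega
  · intro h j l hj hl
    have h1 := (h j).2 hj
    have h2 := mt (h l).1 (by omega)
    rw [Fin.lt_def]
    omega

theorem compl_subset_connectivitySet_iff {w : Equiv.Perm (Fin n)} {U : Finset (Fin (n - 1))} :
    Uᶜ ⊆ connectivitySet w ↔ ∀ i, block U (w i) = block U i := by
  constructor
  · intro h i
    unfold block
    congr 1
    ext k
    simp only [mem_filter, and_congr_right_iff]
    intro hk
    have := mem_connectivitySet_iff.1 (h hk) i
    omega
  · intro h k hk
    simp only [connectivitySet, mem_filter, mem_univ, true_and]
    intro j l hj hl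
    have := block_lt_block (mem_compl.1 hk) hj hl
    rw [← h j, ← h l] at this
    exact (block_mono U).reflect_lt this

theorem subset_descentSet_iff {w : Equiv.Perm (Fin n)} {U : Finset (Fin (n - 1))} :
    U ⊆ descentSet w ↔ ∀ i j, i < j → block U i = block U j → w j < w i := by
  constructor
  · intro h
    have aux : ∀ (d : ℕ) (i j : Fin n), j.val = i.val + d + 1 → block U i = block U j →
        w j < w i := by
      intro d
      induction d with
      | zero =>
        intro i j hj hb
        have hk : (⟨i.val, by have := j.isLt; omega⟩ : Fin (n - 1)) ∈ U := by
          by_contra hk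
          exact (block_lt_block hk (i := i) (j := j) le_rfl (by simp; omega)).ne hb
        have := h hk
        simp only [descentSet, mem_filter, mem_univ, true_and] at this
        have hj' : j = ⟨i.val + 1, by have := j.isLt; omega⟩ := Fin.ext (by simpa using hj)
        rw [hj']
        exact this
      | succ d ih =>
        intro i j hj hb
        have hl : i.val + d + 1 < n := by have := j.isLt; omega
        let l : Fin n := ⟨i.val + d + 1, hl⟩
        have h1 : block U i ≤ block U l := block_mono U (by simp [l, Fin.le_def]; omega)
        have h2 : block U l ≤ block U j := block_mono U (by simp [l, Fin.le_def]; omega)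
        refine lt_trans ?_ (ih i l rfl (by omega))
        have hk : (⟨l.val, by have := j.isLt; simp only [l]; omega⟩ : Fin (n - 1)) ∈ U := by
          by_contra hk
          exact (block_lt_block hk (i := l) (j := j) le_rfl (by simp [l]; omega)).ne (by omega)
        have := h hk
        simp only [descentSet, mem_filter, mem_univ, true_and] at this
        have hj' : j = ⟨l.val + 1, by have := j.isLt; simp only [l]; omega⟩ :=
          Fin.ext (by simp only [l]; omega)
        rw [hj']
        exact this
    intro i j hij
    exact aux (j.val - i.val - 1) i j (by omega)
  · intro h k hk
    simp only [descentSet, mem_filter, mem_univ, true_and]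
    exact h _ _ (by simp [Fin.lt_def]) (block_eq_of_mem hk rfl rfl)

theorem descentSet_subset_of_compl_subset {w : Equiv.Perm (Fin n)} {S : Finset (Fin (n - 1))}
    (h : Sᶜ ⊆ connectivitySet w) : descentSet w ⊆ S := by
  intro k hk
  by_contra hS
  have h1 := h (mem_compl.2 hS)
  simp only [connectivitySet, descentSet, mem_filter, mem_univ, true_and] at h1 hk
  exact lt_asymm hk (h1 _ _ le_rfl (Nat.lt_succ_self _))

theorem compl_subset_connectivitySet_mul_iff {w v : Equiv.Perm (Fin n)}
    {S U : Finset (Fin (n - 1))} (hUS : U ⊆ S) (hv : Uᶜ ⊆ connectivitySet v) :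
    Sᶜ ⊆ connectivitySet (w * v) ↔ Sᶜ ⊆ connectivitySet w := by
  have hv' := compl_subset_connectivitySet_iff.1 ((compl_subset_compl.2 hUS).trans hv)
  rw [compl_subset_connectivitySet_iff, compl_subset_connectivitySet_iff]
  constructor
  · intro h i
    have h1 := h (v.symm i)
    have h2 := hv' (v.symm i)
    simp only [Equiv.Perm.mul_apply, Equiv.apply_symm_apply] at h1 h2
    rw [h1, h2]
  · intro h i
    rw [Equiv.Perm.mul_apply, h, hv']

/-! ### Factorization through blockwise decreasing permutations -/

/-- The analogue for `W_U` of the length formula for the longest element of a coset: on a block,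
`w` reverses the order, so that exactly the non-inversions of `v` there are inversions of
`w * v`; across blocks, `v` preserves the order. -/
theorem inv_mul_add_inv {w v : Equiv.Perm (Fin n)} {U : Finset (Fin (n - 1))}
    (hw : U ⊆ descentSet w) (hv : Uᶜ ⊆ connectivitySet v) :
    inv (w * v) + inv v = inv w := by
  rw [subset_descentSet_iff] at hw
  rw [compl_subset_connectivitySet_iff] at hv
  -- A pair inverted by `v` lies in one block, and so does its image.
  have hsame : ∀ i j, i < j → v j < v i → block U (v j) = block U (v i) := by
    intro i j hij hlt
    have h1 := block_mono U hij.le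
    have h2 := block_mono U hlt.le
    rw [hv, hv] at h2 ⊢
    omega
  have hre : inv w =
      #{p : Fin n × Fin n | v p.1 < v p.2 ∧ w (v p.2) < w (v p.1)} := by
    refine (card_equiv (v.prodCongr v) fun p => ?_).symm
    simp
  have hswap : inv v = #{p : Fin n × Fin n | p.2 < p.1 ∧ v p.1 < v p.2} := by
    refine card_equiv (Equiv.prodComm _ _) fun p => ?_
    simp
  rw [hre, hswap, inv, ← card_union_of_disjoint]
  · congr 1
    ext ⟨i, j⟩
    simp only [mem_union, mem_filter, mem_univ, true_and]
    simp only [Equiv.Perm.mul_apply]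
    constructor
    · rintro (⟨hij, h⟩ | ⟨hij, h⟩)
      · refine ⟨?_, h⟩
        rcases lt_trichotomy (v i) (v j) with h' | h' | h'
        · exact h'
        · exact absurd (v.injective h') hij.ne
        · exact absurd (hw _ _ h' (hsame i j hij h')) h.asymm
      · exact ⟨h, hw _ _ h (hsame j i hij h)⟩
    · rintro ⟨h, h'⟩
      rcases lt_trichotomy i j with hij | rfl | hij
      · exact Or.inl ⟨hij, h'⟩
      · exact absurd h (lt_irrefl _)
      · exact Or.inr ⟨hij, h⟩
  · rw [disjoint_left]
    rintro ⟨i, j⟩ h1 h2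
    simp only [mem_filter, mem_univ, true_and] at h1 h2
    exact lt_asymm h1.1 h2.1

theorem subset_descentSet_iff_disjoint_mul {w v : Equiv.Perm (Fin n)}
    {T U : Finset (Fin (n - 1))} (hTU : T ⊆ U) (hw : U ⊆ descentSet w)
    (hv : Uᶜ ⊆ connectivitySet v) :
    T ⊆ descentSet v ↔ Disjoint T (descentSet (w * v)) := by
  rw [subset_descentSet_iff] at hw
  rw [compl_subset_connectivitySet_iff] at hv
  rw [disjoint_left]
  refine forall₂_congr fun k hk => ?_
  simp only [descentSet, mem_filter, mem_univ, true_and]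
  simp only [Equiv.Perm.mul_apply, not_lt]
  have hk1 : k.val + 1 < n := by have := k.isLt; omega
  have hb : block U (v ⟨k.val, by omega⟩) = block U (v ⟨k.val + 1, hk1⟩) := by
    rw [hv, hv]
    exact block_eq_of_mem (hTU hk) rfl rfl
  constructor
  · intro h
    exact (hw _ _ h hb.symm).le
  · intro h
    rcases lt_trichotomy (v ⟨k.val, by omega⟩) (v ⟨k.val + 1, hk1⟩) with h' | h' | h'
    · exact absurd (hw _ _ h' hb) h.not_gt
    · exact absurd (v.injective h') (by simp [Fin.ext_iff])
    · exact h'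

/-- The key by which positions are sorted so as to make `y` decreasing on every block without
moving anything out of its block. -/
def blockKey (U : Finset (Fin (n - 1))) (y : Equiv.Perm (Fin n)) (i : Fin n) :
    ℕ ×ₗ (Fin n)ᵒᵈ :=
  toLex (block U i, OrderDual.toDual (y i))

theorem blockKey_injective (U : Finset (Fin (n - 1))) (y : Equiv.Perm (Fin n)) :
    Function.Injective (blockKey U y) := by
  intro i j h
  simp only [blockKey, EmbeddingLike.apply_eq_iff_eq, Prod.mk.injEq] at h
  exact h.2

theorem monotone_blockKey_comp_iff {U : Finset (Fin (n - 1))} {y σ : Equiv.Perm (Fin n)} :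
    Monotone (blockKey U y ∘ σ) ↔ Uᶜ ⊆ connectivitySet σ ∧ U ⊆ descentSet (y * σ) := by
  rw [compl_subset_connectivitySet_iff, subset_descentSet_iff]
  constructor
  · intro h
    have hmono : Monotone (block U ∘ σ) := fun i j hij => by
      have := Prod.Lex.le_iff.1 (h hij)
      simp only [blockKey, Function.comp_apply, ofLex_toLex] at this
      rcases this with h | h
      · exact h.le
      · exact h.1.le
    -- Two monotone rearrangements of `block U` coincide.
    have hσ : block U ∘ σ = block U ∘ (1 : Equiv.Perm (Fin n)) :=
      Tuple.unique_monotone hmono (block_mono U)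
    have hσ' : ∀ i, block U (σ i) = block U i := fun i => congrFun hσ i
    refine ⟨hσ', fun i j hij hb => ?_⟩
    have := Prod.Lex.le_iff.1 (h hij.le)
    simp only [blockKey, Function.comp_apply, ofLex_toLex, hσ', hb, lt_irrefl, false_or,
      true_and, OrderDual.toDual_le_toDual] at this
    exact lt_of_le_of_ne this ((y * σ).injective.ne hij.ne')
  · rintro ⟨h1, h2⟩ i j hij
    rcases hij.eq_or_lt with rfl | hij
    · exact le_rfl
    rw [Prod.Lex.le_iff]
    simp only [blockKey, Function.comp_apply, ofLex_toLex, h1, OrderDual.toDual_le_toDual]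
    rcases (block_mono U hij.le).eq_or_lt with hb | hb
    · exact Or.inr ⟨hb, (h2 i j hij hb).le⟩
    · exact Or.inl hb

theorem exists_sort_blocks (U : Finset (Fin (n - 1))) (y : Equiv.Perm (Fin n)) :
    ∃ σ : Equiv.Perm (Fin n), Uᶜ ⊆ connectivitySet σ ∧ U ⊆ descentSet (y * σ) :=
  ⟨Tuple.sort (blockKey U y), monotone_blockKey_comp_iff.1 (Tuple.monotone_sort _)⟩

theorem sort_blocks_unique {U : Finset (Fin (n - 1))} {y σ τ : Equiv.Perm (Fin n)}
    (hσ : Uᶜ ⊆ connectivitySet σ ∧ U ⊆ descentSet (y * σ))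
    (hτ : Uᶜ ⊆ connectivitySet τ ∧ U ⊆ descentSet (y * τ)) : σ = τ :=
  Equiv.ext fun i => blockKey_injective U y <| congrFun
    (Tuple.unique_monotone (monotone_blockKey_comp_iff.2 hσ) (monotone_blockKey_comp_iff.2 hτ)) i

theorem compl_subset_connectivitySet_inv {v : Equiv.Perm (Fin n)} {U : Finset (Fin (n - 1))}
    (hv : Uᶜ ⊆ connectivitySet v) : Uᶜ ⊆ connectivitySet v⁻¹ := by
  rw [compl_subset_connectivitySet_iff] at hv ⊢
  intro i
  simpa using (hv (v⁻¹ i)).symm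

theorem eq_one_of_descentSet_eq_empty {w : Equiv.Perm (Fin n)} (h : descentSet w = ∅) :
    w = 1 := by
  have hmono : StrictMono w := by
    cases n with
    | zero => intro i; exact i.elim0
    | succ m =>
      rw [Fin.strictMono_iff_lt_succ]
      intro i
      have hi : (⟨i.val, i.isLt⟩ : Fin (m + 1 - 1)) ∉ descentSet w := by simp [h]
      simp only [descentSet, mem_filter, mem_univ, true_and, not_lt] at hi
      exact lt_of_le_of_ne hi (w.injective.ne i.castSucc_lt_succ.ne)
  have := Tuple.unique_monotone (f := (id : Fin n → Fin n)) (σ := w) (τ := 1)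
    hmono.monotone monotone_id
  exact Equiv.ext fun i => congrFun this i

/-! ### The matrices -/

section Matrices

variable {R : Type*} [CommRing R]

theorem matA_eq_zero {q : R} {S T : Finset (Fin (n - 1))} (h : ¬ T ⊆ S) : matA n q S T = 0 := by
  unfold matA
  rw [filter_false_of_mem, sum_empty]
  rintro w - ⟨h1, h2⟩
  exact h (h2.trans (descentSet_subset_of_compl_subset h1))

/-- The product of entries is the length generating function of the minimal coset
representatives for `W_T` in `W_S`, whatever `U` is. -/
theorem matA_mul_matA_inv (q : Rˣ) {S T U : Finset (Fin (n - 1))} (hTU : T ⊆ U) (hUS : U ⊆ S) :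
    matA n (q : R) S U * matA n ((q⁻¹ : Rˣ) : R) U T =
      ∑ y : Equiv.Perm (Fin n) with Sᶜ ⊆ connectivitySet y ∧ Disjoint T (descentSet y),
        (q : R) ^ inv y := by
  unfold matA
  rw [sum_mul_sum, ← sum_product']
  refine sum_bij (fun p _ => p.1 * p.2) ?_ ?_ ?_ ?_
  · rintro ⟨w, v⟩ h
    simp only [mem_product, mem_filter, mem_univ, true_and] at h ⊢
    obtain ⟨⟨hw1, hw2⟩, hv1, hv2⟩ := h
    exact ⟨(compl_subset_connectivitySet_mul_iff hUS hv1).2 hw1,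
      (subset_descentSet_iff_disjoint_mul hTU hw2 hv1).1 hv2⟩
  · rintro ⟨w, v⟩ h ⟨w', v'⟩ h' heq
    simp only [mem_product, mem_filter, mem_univ, true_and] at h h' heq
    have hv : v⁻¹ = v'⁻¹ := by
      refine sort_blocks_unique (U := U) (y := w * v)
        ⟨compl_subset_connectivitySet_inv h.2.1, ?_⟩
        ⟨compl_subset_connectivitySet_inv h'.2.1, ?_⟩
      · rw [mul_inv_cancel_right]
        exact h.1.2
      · rw [heq, mul_inv_cancel_right]
        exact h'.1.2
    obtain rfl := inv_injective hv
    rw [mul_right_cancel heq]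
  · intro y hy
    simp only [mem_filter, mem_univ, true_and] at hy
    obtain ⟨σ, h1, h2⟩ := exists_sort_blocks U y
    have h1' := compl_subset_connectivitySet_inv h1
    have hy' : y * σ * σ⁻¹ = y := mul_inv_cancel_right _ _
    refine ⟨(y * σ, σ⁻¹), ?_, hy'⟩
    simp only [mem_product, mem_filter, mem_univ, true_and]
    refine ⟨⟨(compl_subset_connectivitySet_mul_iff hUS h1).2 hy.1, h2⟩, h1', ?_⟩
    rw [subset_descentSet_iff_disjoint_mul hTU h2 h1', hy']
    exact hy.2
  · rintro ⟨w, v⟩ h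
    simp only [mem_product, mem_filter, mem_univ, true_and] at h
    rw [← inv_mul_add_inv h.1.2 h.2.1, pow_add, mul_assoc, ← mul_pow, Units.mul_inv, one_pow,
      mul_one]

theorem sum_inv_disjoint_self (q : R) (S : Finset (Fin (n - 1))) :
    ∑ y : Equiv.Perm (Fin n) with Sᶜ ⊆ connectivitySet y ∧ Disjoint S (descentSet y),
      q ^ inv y = 1 := by
  have : (univ.filter fun y : Equiv.Perm (Fin n) =>
      Sᶜ ⊆ connectivitySet y ∧ Disjoint S (descentSet y)) = {1} := by
    ext y
    simp only [mem_filter, mem_univ, true_and, mem_singleton]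
    constructor
    · rintro ⟨h1, h2⟩
      refine eq_one_of_descentSet_eq_empty ?_
      exact disjoint_self.1 (h2.mono_left (descentSet_subset_of_compl_subset h1))
    · rintro rfl
      refine ⟨compl_subset_connectivitySet_iff.2 fun i => rfl, ?_⟩
      have : descentSet (1 : Equiv.Perm (Fin n)) = ∅ := by
        simp [descentSet]
      simp [this]
  rw [this, sum_singleton]
  have : inv (1 : Equiv.Perm (Fin n)) = 0 := by
    simp only [inv, card_eq_zero, filter_eq_empty_iff]
    rintro p - ⟨h1, h2⟩
    exact lt_asymm h1 h2
  rw [this, pow_zero]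

variable {α : Type*} [Fintype α] [DecidableEq α]

theorem sum_neg_one_pow_card_between (S T : Finset α) :
    ∑ U with T ⊆ U ∧ U ⊆ S, (-1 : R) ^ #U = if T = S then (-1) ^ #S else 0 := by
  by_cases hTS : T ⊆ S
  · have hI : (univ.filter fun U : Finset α => T ⊆ U ∧ U ⊆ S) =
        (S \ T).powerset.image (T ∪ ·) := by
      rw [← Icc_eq_image_powerset hTS]
      ext U
      simp
    rw [hI, sum_image]
    · have hc : ∀ V ∈ (S \ T).powerset, (-1 : R) ^ #(T ∪ V) = (-1) ^ #T * (-1) ^ #V := by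
        intro V hV
        rw [← pow_add, card_union_of_disjoint]
        exact disjoint_of_subset_right (mem_powerset.1 hV) disjoint_sdiff
      rw [sum_congr rfl hc, ← mul_sum]
      have hz := congrArg (Int.cast : ℤ → R) (sum_powerset_neg_one_pow_card (x := S \ T))
      push_cast at hz
      rw [hz]
      by_cases hE : T = S
      · subst hE
        simp
      · have : ¬ S ⊆ T := fun h => hE (hTS.antisymm h)
        simp [hE, sdiff_eq_empty_iff_subset, this]
    · intro V hV V' hV' h
      have hd : ∀ V ∈ (S \ T).powerset, (T ∪ V) \ T = V := fun V hV => by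
        rw [union_sdiff_left, sdiff_eq_self_of_disjoint]
        exact (disjoint_of_subset_right (mem_powerset.1 hV) disjoint_sdiff).symm
      rw [← hd V hV, ← hd V' hV']
      exact congrArg (· \ T) h
  · rw [filter_false_of_mem, sum_empty, if_neg]
    · rintro rfl
      exact hTS subset_rfl
    · rintro U - ⟨h1, h2⟩
      exact hTS (h1.trans h2)

variable (R α) in
/-- The diagonal matrix of the signs `(-1) ^ #S`. -/
def signMatrix : Matrix (Finset α) (Finset α) R :=
  Matrix.diagonal fun S => (-1) ^ #S

variable (R α) in
/-- The incidence matrix of containment: the entry in row `S` and column `T` is `1` if `T ⊆ S`. -/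
def containMatrix : Matrix (Finset α) (Finset α) R :=
  fun S T => if T ⊆ S then 1 else 0

theorem signMatrix_conj_apply (M : Matrix (Finset α) (Finset α) R) (S T : Finset α) :
    (signMatrix R α * M * signMatrix R α) S T = (-1) ^ (#S + #T) * M S T := by
  rw [signMatrix, Matrix.mul_diagonal, Matrix.diagonal_mul, pow_add]
  ring

theorem signMatrix_mul_self : signMatrix R α * signMatrix R α = 1 := by
  rw [signMatrix, Matrix.diagonal_mul_diagonal, ← Matrix.diagonal_one]
  congr 1
  funext S
  rw [← mul_pow]
  simp

theorem containMatrix_mul_sign_mul_containMatrix :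
    containMatrix R α * signMatrix R α * containMatrix R α = signMatrix R α := by
  ext S T
  rw [Matrix.mul_apply, signMatrix, Matrix.diagonal_apply]
  have : ∀ U, (containMatrix R α * Matrix.diagonal (fun V => (-1) ^ #V) :
      Matrix (Finset α) (Finset α) R) S U *
      containMatrix R α U T = if T ⊆ U ∧ U ⊆ S then (-1 : R) ^ #U else 0 := by
    intro U
    rw [Matrix.mul_diagonal, containMatrix, containMatrix]
    split_ifs <;> simp_all
  rw [sum_congr rfl fun U _ => this U, ← sum_filter, sum_neg_one_pow_card_between]
  simp only [eq_comm]

theorem matA_mul_signed_matA (q : Rˣ) :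
    matA n (q : R) * (signMatrix R (Fin (n - 1)) * matA n ((q⁻¹ : Rˣ) : R) *
      signMatrix R (Fin (n - 1))) = 1 := by
  ext S T
  rw [Matrix.mul_apply, Matrix.one_apply]
  have : ∀ U, matA n (q : R) S U *
      (signMatrix R (Fin (n - 1)) * matA n ((q⁻¹ : Rˣ) : R) * signMatrix R (Fin (n - 1))) U T =
      if T ⊆ U ∧ U ⊆ S then (-1) ^ #U * ((-1) ^ #T *
        ∑ y : Equiv.Perm (Fin n) with Sᶜ ⊆ connectivitySet y ∧ Disjoint T (descentSet y),
          (q : R) ^ inv y) else 0 := by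
    intro U
    rw [signMatrix_conj_apply]
    split_ifs with h
    · rw [← matA_mul_matA_inv q h.1 h.2, pow_add]
      ring
    · rw [not_and_or] at h
      rcases h with h | h <;> rw [matA_eq_zero h] <;> simp
  rw [sum_congr rfl fun U _ => this U, ← sum_filter, ← sum_mul, sum_neg_one_pow_card_between]
  by_cases h : T = S
  · subst h
    rw [if_pos rfl, if_pos rfl, sum_inv_disjoint_self, mul_one, ← mul_pow]
    simp
  · rw [if_neg h, if_neg (Ne.symm h), zero_mul]

theorem matB_eq (q : R) : matB n q = containMatrix R (Fin (n - 1)) * matΓ n q := by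
  ext S T
  simp only [Matrix.mul_apply, containMatrix, matΓ, matB, sum_filter, mul_sum]
  rw [sum_comm]
  refine sum_congr rfl fun w _ => ?_
  -- Only the term indexed by the complement of the connectivity set survives.
  rw [sum_eq_single (connectivitySet w)ᶜ]
  · have hc : Sᶜ ⊆ connectivitySet w ↔ (connectivitySet w)ᶜ ⊆ S := compl_le_iff_compl_le
    by_cases h1 : (connectivitySet w)ᶜ ⊆ S <;> simp [hc, h1]
  · intro U _ hU
    have hne : connectivitySet w ≠ Uᶜ := fun h => hU (by rw [h, compl_compl])
    simp [hne]
  · simp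

theorem matΓ_mul_containMatrix_apply (q : R) (S T : Finset (Fin (n - 1))) :
    (matΓ n q * containMatrix R (Fin (n - 1))) S T =
      ∑ w : Equiv.Perm (Fin n) with connectivitySet w = Sᶜ ∧ T ⊆ descentSet w, q ^ inv w := by
  simp only [Matrix.mul_apply, containMatrix, matΓ, sum_filter, sum_mul]
  rw [sum_comm]
  refine sum_congr rfl fun w _ => ?_
  rw [sum_eq_single (descentSet w)]
  · by_cases h1 : T ⊆ descentSet w <;> simp [h1]
  · intro U _ hU
    simp [hU.symm]
  · simp

theorem matA_eq (q : R) :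
    matA n q = matB n q * containMatrix R (Fin (n - 1)) := by
  ext S T
  simp only [Matrix.mul_apply, containMatrix, matB, matA, sum_filter, sum_mul]
  rw [sum_comm]
  refine sum_congr rfl fun w _ => ?_
  rw [sum_eq_single (descentSet w)]
  · by_cases h1 : T ⊆ descentSet w <;> simp [h1]
  · intro U _ hU
    simp [hU.symm]
  · simp

theorem matB_mul_signed (q : Rˣ) :
    matB n (q : R) * (signMatrix R (Fin (n - 1)) *
      (matΓ n ((q⁻¹ : Rˣ) : R) * containMatrix R (Fin (n - 1))) *
        signMatrix R (Fin (n - 1))) = 1 := by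
  have h := matA_mul_signed_matA (n := n) q
  rw [matA_eq, matA_eq, matB_eq ((q⁻¹ : Rˣ) : R)] at h
  rw [← h]
  nth_rewrite 1 [← containMatrix_mul_sign_mul_containMatrix]
  simp only [Matrix.mul_assoc]

theorem matΓ_mul_signed (q : Rˣ) :
    matΓ n (q : R) * (signMatrix R (Fin (n - 1)) * matΓ n ((q⁻¹ : Rˣ) : R) *
      signMatrix R (Fin (n - 1))) = 1 := by
  have h := matB_mul_signed (n := n) q
  -- Moving the left factor `Z` of `B = Z Γ` to the right end produces `Z J Z = J`.
  rw [matB_eq, Matrix.mul_assoc, mul_eq_one_comm] at h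
  rw [← h]
  nth_rewrite 2 [← containMatrix_mul_sign_mul_containMatrix]
  simp only [Matrix.mul_assoc]

theorem isUnit_and_inv_apply_of_mul_signed {M N : Matrix (Finset α) (Finset α) R}
    (h : M * (signMatrix R α * N * signMatrix R α) = 1) :
    IsUnit M ∧ ∀ S T, M⁻¹ S T = (-1) ^ (#S + #T) * N S T :=
  ⟨IsUnit.of_mul_eq_one _ h, fun S T => by
    rw [Matrix.inv_eq_right_inv h, signMatrix_conj_apply]⟩

end Matrices

end PermStat

theorem mainTheorem3 {R : Type*} [CommRing R] (q : Rˣ) (n : ℕ) :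
    (IsUnit (PermStat.matA n (q : R)) ∧
      ∀ S T : Finset (Fin (n - 1)),
        (PermStat.matA n (q : R))⁻¹ S T =
          (-1) ^ (S.card + T.card) * PermStat.matA n ((q⁻¹ : Rˣ) : R) S T) ∧
    (IsUnit (PermStat.matB n (q : R)) ∧
      ∀ S T : Finset (Fin (n - 1)),
        (PermStat.matB n (q : R))⁻¹ S T =
          (-1) ^ (S.card + T.card) *
            ∑ w : Equiv.Perm (Fin n) with
              PermStat.connectivitySet w = Sᶜ ∧ T ⊆ PermStat.descentSet w,
              ((q⁻¹ : Rˣ) : R) ^ PermStat.inv w) ∧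
    (IsUnit (PermStat.matΓ n (q : R)) ∧
      ∀ S T : Finset (Fin (n - 1)),
        (PermStat.matΓ n (q : R))⁻¹ S T =
          (-1) ^ (S.card + T.card) * PermStat.matΓ n ((q⁻¹ : Rˣ) : R) S T) := by
  refine ⟨PermStat.isUnit_and_inv_apply_of_mul_signed (PermStat.matA_mul_signed_matA q), ?_,
    PermStat.isUnit_and_inv_apply_of_mul_signed (PermStat.matΓ_mul_signed q)⟩
  simp only [← PermStat.matΓ_mul_containMatrix_apply]
  exact PermStat.isUnit_and_inv_apply_of_mul_signed (PermStat.matB_mul_signed q)
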